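/- Let $\mathbf{k}$ be a field of characteristic zero. An $\mathbb{S}$-module is a graded $\mathbf{k}$-vector space $V=\bigoplus_{m\ge 0}V_m$ with a linear action of the symmetric group $S_m$ on each $V_m$. $\mathbb{S}$-modules form a symmetric monoidal category with $(V\otimes W)_p=\bigoplus_{m+n=p}\operatorname{Ind}_{S_m\times S_n}^{S_p}(V_m\otimes W_n)$; thus a morphism $V\otimes W\to U$ is a family of bilinear $S_m\times S_n$-equivariant maps $V_m\times W_n\to U_{m+n}$. A twisted commutative algebra is a (unital) commutative monoid in this category, and $\operatorname{Sym}V$ denotes the free one generated by $V$. For $\tau\in S_r$ and $a_1,\dots,a_r\ge 0$ let $\tau^{a_1,\dots,a_r}\in S_{a_1+\dots+a_r}$ be the permutation that moves the $i$-th of the consecutive blocks of sizes $a_1,\dots,a_r$ to the $\tau(i)$-th place, where $\tau$ is written as $(\tau(1)\cdots\tau(r))$; write $|x|$ for the degree of a homogeneous element $x$. A twisted Poisson structure on a twisted commutative algebra $A$ is a morphism $\{\,,\}\colon A\otimes A\to A$ of $\mathbb{S}$-modules such that for all homogeneous $u,v,w\in A$ $$\{w,v\}=-(21)^{|v|,|w|}\{v,w\},\tag{1}$$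 $$\{u,\{v,w\}\}+(231)^{|v|,|w|,|u|}\{v,\{w,u\}\}+(312)^{|w|,|u|,|v|}\{w,\{u,v\}\}=0,\tag{2}$$ $$\{uv,w\}=u\{v,w\}+(213)^{|v|,|u|,|w|}\bigl(v\{u,w\}\bigr).\tag{3}$$ Proposition. Let $V$ be an $\mathbb{S}$-module and let $\{\,,\}\colon V\otimes V\to\operatorname{Sym}V$ be a morphism of $\mathbb{S}$-modules satisfying the twisted skew-symmetry (1) for all homogeneous $v,w\in V$. Then this bracket has a unique extension to a morphism $\{\,,\}\colon V\otimes\operatorname{Sym}V\to\operatorname{Sym}V$ of $\mathbb{S}$-modules that satisfies the Leibniz rule $\{u,pq\}=\{u,p\}q+(213)^{|p|,|u|,|q|}(p\{u,q\})$ for all homogeneous $u\in V$ and $p,q\in\operatorname{Sym}V$. If, with the outer brackets given by this extension, the twisted Jacobi identity (2) holds for all homogeneous $u,v,w\in V$, then there is exactly one twisted Poisson structure on $\operatorname{Sym}V$ that restricts to the given bracket on $V\otimes V$. -/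

import Mathlib

universe u v w v₁ v₂ v₃

/-- An `𝕊`-module over `k`: a graded vector space `V = ⨁ₙ Vₙ`, given by its components, with a
linear left action of the symmetric group `Sₙ` on `Vₙ` for all `n`. -/
structure SModule (k : Type u) [Field k] where
  carrier : ℕ → Type v
  [addCommGroup : ∀ n, AddCommGroup (carrier n)]
  [module : ∀ n, Module k (carrier n)]
  ρ : ∀ n, Representation k (Equiv.Perm (Fin n)) (carrier n)

attribute [instance] SModule.addCommGroup SModule.module

namespace SModule

variable {k : Type u} [Field k]

instance : CoeFun (SModule.{u, v} k) (fun _ => ℕ → Type v) := ⟨SModule.carrier⟩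

theorem eq_of_finEquiv {m n : ℕ} (e : Fin m ≃ Fin n) : m = n := by
  simpa using Fintype.card_congr e

/-- The identification of `V_m` with `V_n` when `m = n`. -/
def cast (V : SModule.{u, v} k) {m n : ℕ} (h : m = n) : V m →ₗ[k] V n :=
  h ▸ LinearMap.id

/-- The action of a bijection `e : {1,…,m} ≃ {1,…,n}` (so `m = n`): the action of the corresponding
element of `S_m`, followed by the identification `V_m = V_n`. It lets us write block permutations as
bijections between, say, `Fin (m + n)` and `Fin (n + m)`. -/
def map (V : SModule.{u, v} k) {m n : ℕ} (e : Fin m ≃ Fin n) : V m →ₗ[k] V n :=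
  V.cast (eq_of_finEquiv e) ∘ₗ V.ρ m (e.trans (finCongr (eq_of_finEquiv e).symm))

theorem map_perm (V : SModule.{u, v} k) {n : ℕ} (σ : Equiv.Perm (Fin n)) :
    V.map σ = V.ρ n σ := rfl

theorem map_refl (V : SModule.{u, v} k) {n : ℕ} (x : V n) : V.map (Equiv.refl (Fin n)) x = x := by
  have h : V.ρ n (1 : Equiv.Perm (Fin n)) x = x := by rw [map_one]; rfl
  exact h

theorem map_trans (V : SModule.{u, v} k) {l m n : ℕ} (e : Fin l ≃ Fin m) (f : Fin m ≃ Fin n)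
    (x : V l) : V.map (e.trans f) x = V.map f (V.map e x) := by
  obtain rfl := eq_of_finEquiv e
  obtain rfl := eq_of_finEquiv f
  have h : V.ρ l ((f : Equiv.Perm (Fin l)) * e) x = V.ρ l f (V.ρ l e x) := by rw [map_mul]; rfl
  exact h

/-- A morphism of `𝕊`-modules: a degree-preserving equivariant linear map. -/
@[ext] structure Hom (V : SModule.{u, v} k) (W : SModule.{u, w} k) where
  toFun : ∀ n, V n →ₗ[k] W n
  equivariant : ∀ (n : ℕ) (σ : Equiv.Perm (Fin n)) (x : V n),
    toFun n (V.ρ n σ x) = W.ρ n σ (toFun n x)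

/-- The bijection `Fin (a + c) ≃ Fin (b + d)` acting by `e` on the first block and by `f` on the
second one. For permutations it is the embedding `S_a × S_c ⊆ S_{a+c}`. -/
def blockSum {a b c d : ℕ} (e : Fin a ≃ Fin b) (f : Fin c ≃ Fin d) : Fin (a + c) ≃ Fin (b + d) :=
  finSumFinEquiv.symm.trans ((Equiv.sumCongr e f).trans finSumFinEquiv)

/-- The order-preserving bijection `Fin (a + b + c) ≃ Fin (a + (b + c))`. -/
def assocB (a b c : ℕ) : Fin (a + b + c) ≃ Fin (a + (b + c)) := finCongr (Nat.add_assoc a b c)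

/-- The block permutation `(21)^{a,b}`: the first block (of size `a`) is moved behind the second
one. -/
def perm21 (a b : ℕ) : Fin (a + b) ≃ Fin (b + a) := finAddFlip

/-- The block permutation `(231)^{a,b,c}`: the blocks (of sizes `a`, `b`, `c`) are moved to the
places 2, 3, 1. -/
def perm231 (a b c : ℕ) : Fin (a + (b + c)) ≃ Fin (c + (a + b)) :=
  (assocB a b c).symm.trans (perm21 (a + b) c)

/-- The block permutation `(312)^{a,b,c}`: the blocks (of sizes `a`, `b`, `c`) are moved to the
places 3, 1, 2. -/
def perm312 (a b c : ℕ) : Fin (a + (b + c)) ≃ Fin (b + (c + a)) :=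
  (perm21 a (b + c)).trans (assocB b c a)

/-- The block permutation `(213)^{a,b,c}`: the blocks (of sizes `a`, `b`, `c`) are moved to the
places 2, 1, 3. -/
def perm213 (a b c : ℕ) : Fin (a + (b + c)) ≃ Fin (b + a + c) :=
  (assocB a b c).symm.trans (blockSum (perm21 a b) (Equiv.refl (Fin c)))

/-- A morphism of `𝕊`-modules `U ⊗ V → W`. As `(U ⊗ V)_p` is the direct sum over `m + n = p` of the
induced modules `Ind_{S_m × S_n}^{S_p} (U_m ⊗ V_n)`, this is a family of bilinear
`S_m × S_n`-equivariant maps `U_m × V_n → W_{m+n}`. -/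
@[ext] structure BiHom (U : SModule.{u, v₁} k) (V : SModule.{u, v₂} k) (W : SModule.{u, v₃} k) where
  toFun : ∀ m n, U m →ₗ[k] V n →ₗ[k] W (m + n)
  equivariant : ∀ (m n : ℕ) (σ : Equiv.Perm (Fin m)) (τ : Equiv.Perm (Fin n)) (x : U m) (y : V n),
    toFun m n (U.ρ m σ x) (V.ρ n τ y) = W.ρ (m + n) (blockSum σ τ) (toFun m n x y)

end SModule

open SModule

/-- A (unital) twisted commutative algebra: a commutative monoid in the symmetric monoidal category
of `𝕊`-modules. The right unit law follows from the left one by commutativity. -/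
structure TwistedCommAlgebra (k : Type u) [Field k] extends SModule.{u, v} k where
  one : carrier 0
  mul : BiHom toSModule toSModule toSModule
  one_mul : ∀ (n : ℕ) (x : carrier n),
    toSModule.map (finCongr (Nat.zero_add n)) (mul.toFun 0 n one x) = x
  mul_assoc : ∀ (l m n : ℕ) (x : carrier l) (y : carrier m) (z : carrier n),
    toSModule.map (assocB l m n) (mul.toFun (l + m) n (mul.toFun l m x y) z) =
      mul.toFun l (m + n) x (mul.toFun m n y z)
  mul_comm : ∀ (m n : ℕ) (x : carrier m) (y : carrier n),
    mul.toFun n m y x = toSModule.map (perm21 m n) (mul.toFun m n x y)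

/-- A morphism of twisted commutative algebras. -/
@[ext] structure TwistedCommAlgebra.AlgHom {k : Type u} [Field k] (A : TwistedCommAlgebra.{u, v} k)
    (B : TwistedCommAlgebra.{u, w} k) extends SModule.Hom A.toSModule B.toSModule where
  map_one : toFun 0 A.one = B.one
  map_mul : ∀ (m n : ℕ) (x : A.carrier m) (y : A.carrier n),
    toFun (m + n) (A.mul.toFun m n x y) = B.mul.toFun m n (toFun m x) (toFun n y)

/-! ### The free twisted commutative algebra `Sym V` -/

namespace SModule

variable {k : Type u} [Field k]

namespace SymAlg

/-- Formal expressions in the elements of `V`, graded by degree. -/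
inductive Pre (V : SModule.{u, v} k) : ℕ → Type (max u v)
  | of {n : ℕ} (x : V n) : Pre V n
  | zero {n : ℕ} : Pre V n
  | add {n : ℕ} (x y : Pre V n) : Pre V n
  | smul {n : ℕ} (c : k) (x : Pre V n) : Pre V n
  | act {m n : ℕ} (e : Fin m ≃ Fin n) (x : Pre V m) : Pre V n
  | one : Pre V 0
  | mul {m n : ℕ} (x : Pre V m) (y : Pre V n) : Pre V (m + n)

/-- The relations that make formal expressions into a twisted commutative algebra receiving a
morphism of `𝕊`-modules from `V`. -/
inductive Rel (V : SModule.{u, v} k) : ∀ {n : ℕ}, Pre V n → Pre V n → Prop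
  -- compatibility with the operations
  | add_left {n : ℕ} {x x' : Pre V n} (y : Pre V n) : Rel V x x' → Rel V (.add x y) (.add x' y)
  | add_right {n : ℕ} (x : Pre V n) {y y' : Pre V n} : Rel V y y' → Rel V (.add x y) (.add x y')
  | smul_congr {n : ℕ} (c : k) {x x' : Pre V n} : Rel V x x' → Rel V (.smul c x) (.smul c x')
  | act_congr {m n : ℕ} (e : Fin m ≃ Fin n) {x x' : Pre V m} :
      Rel V x x' → Rel V (.act e x) (.act e x')
  | mul_left {m n : ℕ} {x x' : Pre V m} (y : Pre V n) : Rel V x x' → Rel V (.mul x y) (.mul x' y)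
  | mul_right {m n : ℕ} (x : Pre V m) {y y' : Pre V n} : Rel V y y' → Rel V (.mul x y) (.mul x y')
  -- vector space axioms in each degree
  | add_assoc {n : ℕ} (x y z : Pre V n) : Rel V (.add (.add x y) z) (.add x (.add y z))
  | add_comm {n : ℕ} (x y : Pre V n) : Rel V (.add x y) (.add y x)
  | zero_add {n : ℕ} (x : Pre V n) : Rel V (.add .zero x) x
  | neg_add {n : ℕ} (x : Pre V n) : Rel V (.add (.smul (-1) x) x) .zero
  | one_smul {n : ℕ} (x : Pre V n) : Rel V (.smul 1 x) x
  | smul_smul {n : ℕ} (c d : k) (x : Pre V n) : Rel V (.smul (c * d) x) (.smul c (.smul d x))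
  | smul_add {n : ℕ} (c : k) (x y : Pre V n) :
      Rel V (.smul c (.add x y)) (.add (.smul c x) (.smul c y))
  | add_smul {n : ℕ} (c d : k) (x : Pre V n) :
      Rel V (.smul (c + d) x) (.add (.smul c x) (.smul d x))
  -- linear actions of the symmetric groups
  | act_add {m n : ℕ} (e : Fin m ≃ Fin n) (x y : Pre V m) :
      Rel V (.act e (.add x y)) (.add (.act e x) (.act e y))
  | act_smul {m n : ℕ} (e : Fin m ≃ Fin n) (c : k) (x : Pre V m) :
      Rel V (.act e (.smul c x)) (.smul c (.act e x))
  | act_refl {n : ℕ} (x : Pre V n) : Rel V (.act (Equiv.refl (Fin n)) x) x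
  | act_trans {l m n : ℕ} (e : Fin l ≃ Fin m) (f : Fin m ≃ Fin n) (x : Pre V l) :
      Rel V (.act (e.trans f) x) (.act f (.act e x))
  -- the generators form a copy of `V`
  | of_add {n : ℕ} (x y : V n) : Rel V (.of (x + y)) (.add (.of x) (.of y))
  | of_smul {n : ℕ} (c : k) (x : V n) : Rel V (.of (c • x)) (.smul c (.of x))
  | of_act {n : ℕ} (σ : Equiv.Perm (Fin n)) (x : V n) : Rel V (.of (V.ρ n σ x)) (.act σ (.of x))
  -- the multiplication is a morphism of `𝕊`-modules
  | add_mul {m n : ℕ} (x x' : Pre V m) (y : Pre V n) :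
      Rel V (.mul (.add x x') y) (.add (.mul x y) (.mul x' y))
  | mul_add {m n : ℕ} (x : Pre V m) (y y' : Pre V n) :
      Rel V (.mul x (.add y y')) (.add (.mul x y) (.mul x y'))
  | smul_mul {m n : ℕ} (c : k) (x : Pre V m) (y : Pre V n) :
      Rel V (.mul (.smul c x) y) (.smul c (.mul x y))
  | mul_smul {m n : ℕ} (c : k) (x : Pre V m) (y : Pre V n) :
      Rel V (.mul x (.smul c y)) (.smul c (.mul x y))
  | act_mul_act {m n : ℕ} (σ : Equiv.Perm (Fin m)) (τ : Equiv.Perm (Fin n)) (x : Pre V m)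
      (y : Pre V n) : Rel V (.mul (.act σ x) (.act τ y)) (.act (blockSum σ τ) (.mul x y))
  -- monoid axioms
  | one_mul {n : ℕ} (x : Pre V n) : Rel V (.act (finCongr (Nat.zero_add n)) (.mul .one x)) x
  | mul_assoc {l m n : ℕ} (x : Pre V l) (y : Pre V m) (z : Pre V n) :
      Rel V (.act (assocB l m n) (.mul (.mul x y) z)) (.mul x (.mul y z))
  | mul_comm {m n : ℕ} (x : Pre V m) (y : Pre V n) :
      Rel V (.mul y x) (.act (perm21 m n) (.mul x y))

/-- The degree `n` component of `Sym V`. -/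
def Carrier (V : SModule.{u, v} k) (n : ℕ) : Type (max u v) := Quot (@Rel k _ V n)

variable (V : SModule.{u, v} k)

instance (n : ℕ) : Zero (Carrier V n) := ⟨Quot.mk _ .zero⟩

instance (n : ℕ) : Add (Carrier V n) :=
  ⟨Quot.map₂ .add (fun x _ _ h => .add_right x h) (fun _ _ y h => .add_left y h)⟩

instance (n : ℕ) : Neg (Carrier V n) :=
  ⟨Quot.map (.smul (-1)) (fun _ _ h => .smul_congr _ h)⟩

instance (n : ℕ) : AddCommGroup (Carrier V n) where
  add_assoc := by rintro ⟨x⟩ ⟨y⟩ ⟨z⟩; exact Quot.sound (.add_assoc x y z)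
  add_comm := by rintro ⟨x⟩ ⟨y⟩; exact Quot.sound (.add_comm x y)
  zero_add := by rintro ⟨x⟩; exact Quot.sound (.zero_add x)
  add_zero := by
    rintro ⟨x⟩
    exact (Quot.sound (.add_comm x .zero)).trans (Quot.sound (.zero_add x))
  neg_add_cancel := by rintro ⟨x⟩; exact Quot.sound (.neg_add x)
  nsmul := nsmulRec
  zsmul := zsmulRec

instance (n : ℕ) : SMul k (Carrier V n) :=
  ⟨fun c => Quot.map (.smul c) (fun _ _ h => .smul_congr c h)⟩

instance (n : ℕ) : Module k (Carrier V n) :=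
  Module.ofMinimalAxioms
    (by rintro c ⟨x⟩ ⟨y⟩; exact Quot.sound (.smul_add c x y))
    (by rintro c d ⟨x⟩; exact Quot.sound (.add_smul c d x))
    (by rintro c d ⟨x⟩; exact Quot.sound (.smul_smul c d x))
    (by rintro ⟨x⟩; exact Quot.sound (.one_smul x))

/-- The action of bijections on `Sym V`. -/
def act {m n : ℕ} (e : Fin m ≃ Fin n) : Carrier V m →ₗ[k] Carrier V n where
  toFun := Quot.map (.act e) (fun _ _ h => .act_congr e h)
  map_add' := by rintro ⟨x⟩ ⟨y⟩; exact Quot.sound (.act_add e x y)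
  map_smul' := by rintro c ⟨x⟩; exact Quot.sound (.act_smul e c x)

/-- `Sym V` as an `𝕊`-module. -/
def toSModule : SModule.{u, max u v} k where
  carrier := Carrier V
  ρ n :=
    { toFun := fun σ => act V σ
      map_one' := by ext ⟨x⟩; exact Quot.sound (.act_refl x)
      map_mul' := fun σ τ => by ext ⟨x⟩; exact Quot.sound (.act_trans τ σ x) }

theorem toSModule_map {m n : ℕ} (e : Fin m ≃ Fin n) : (toSModule V).map e = act V e := by
  obtain rfl := eq_of_finEquiv e
  rfl

/-- The multiplication of `Sym V`. -/
def mul : BiHom (toSModule V) (toSModule V) (toSModule V) where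
  toFun m n := LinearMap.mk₂ k
    (Quot.map₂ .mul (fun x _ _ h => .mul_right x h) (fun _ _ y h => .mul_left y h) :
      Carrier V m → Carrier V n → Carrier V (m + n))
    (by rintro ⟨x⟩ ⟨x'⟩ ⟨y⟩; exact Quot.sound (.add_mul x x' y))
    (by rintro c ⟨x⟩ ⟨y⟩; exact Quot.sound (.smul_mul c x y))
    (by rintro ⟨x⟩ ⟨y⟩ ⟨y'⟩; exact Quot.sound (.mul_add x y y'))
    (by rintro c ⟨x⟩ ⟨y⟩; exact Quot.sound (.mul_smul c x y))
  equivariant := by rintro m n σ τ ⟨x⟩ ⟨y⟩; exact Quot.sound (.act_mul_act σ τ x y)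

end SymAlg

/-- `Sym V`, the free twisted commutative algebra generated by the `𝕊`-module `V`. Its universal
property is `SModule.existsUnique_symLift`. -/
def symAlgebra (V : SModule.{u, v} k) : TwistedCommAlgebra.{u, max u v} k where
  toSModule := SymAlg.toSModule V
  one := Quot.mk _ .one
  mul := SymAlg.mul V
  one_mul := by
    rintro n ⟨x⟩; rw [SymAlg.toSModule_map]; exact Quot.sound (.one_mul x)
  mul_assoc := by
    rintro l m n ⟨x⟩ ⟨y⟩ ⟨z⟩; rw [SymAlg.toSModule_map]; exact Quot.sound (.mul_assoc x y z)
  mul_comm := by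
    rintro m n ⟨x⟩ ⟨y⟩; rw [SymAlg.toSModule_map]; exact Quot.sound (.mul_comm x y)

/-- `Sym V` as an `𝕊`-module. -/
abbrev Sym (V : SModule.{u, v} k) : SModule.{u, max u v} k := V.symAlgebra.toSModule

/-- The canonical morphism `V → Sym V`. -/
def symι (V : SModule.{u, v} k) : Hom V V.Sym where
  toFun n :=
    { toFun := fun x => Quot.mk _ (.of x)
      map_add' := fun x y => Quot.sound (.of_add x y)
      map_smul' := fun c x => Quot.sound (.of_smul c x) }
  equivariant _ σ x := Quot.sound (.of_act σ x)

/-- The value of a formal expression in a twisted commutative algebra. -/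
def SymAlg.eval {V : SModule.{u, v} k} {A : TwistedCommAlgebra.{u, w} k} (f : Hom V A.toSModule) :
    ∀ {n : ℕ}, SymAlg.Pre V n → A.carrier n
  | _, .of x => f.toFun _ x
  | _, .zero => 0
  | _, .add x y => SymAlg.eval f x + SymAlg.eval f y
  | _, .smul c x => c • SymAlg.eval f x
  | _, .act e x => A.toSModule.map e (SymAlg.eval f x)
  | _, .one => A.one
  | _, .mul x y => A.mul.toFun _ _ (SymAlg.eval f x) (SymAlg.eval f y)

theorem SymAlg.eval_rel {V : SModule.{u, v} k} {A : TwistedCommAlgebra.{u, w} k}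
    (f : Hom V A.toSModule) {n : ℕ} {x y : SymAlg.Pre V n} (h : SymAlg.Rel V x y) :
    SymAlg.eval f x = SymAlg.eval f y := by
  induction h with
  | add_assoc => simp only [SymAlg.eval]; exact _root_.add_assoc _ _ _
  | add_comm => simp only [SymAlg.eval]; exact _root_.add_comm _ _
  | smul_smul => simp only [SymAlg.eval]; exact SemigroupAction.mul_smul _ _ _
  | add_smul => simp only [SymAlg.eval]; exact _root_.add_smul _ _ _
  | act_refl => simp only [SymAlg.eval]; exact map_refl _ _
  | act_trans => simp only [SymAlg.eval]; exact map_trans _ _ _ _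
  | of_act => simp only [SymAlg.eval]; exact f.equivariant _ _ _
  | act_mul_act => simp only [SymAlg.eval]; exact A.mul.equivariant _ _ _ _ _ _
  | one_mul => simp only [SymAlg.eval]; exact A.one_mul _ _
  | mul_assoc => simp only [SymAlg.eval]; exact A.mul_assoc _ _ _ _ _ _
  | mul_comm => simp only [SymAlg.eval]; exact A.mul_comm _ _ _ _
  | _ => simp_all [SymAlg.eval]

/-- The universal property of `Sym V`: it is the free twisted commutative algebra on `V`. -/
theorem existsUnique_symLift (V : SModule.{u, v} k) (A : TwistedCommAlgebra.{u, w} k)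
    (f : Hom V A.toSModule) : ∃! F : TwistedCommAlgebra.AlgHom V.symAlgebra A,
      ∀ (n : ℕ) (x : V n), F.toFun n (V.symι.toFun n x) = f.toFun n x := by
  refine ⟨{ toFun := fun _ =>
              { toFun := Quot.lift (SymAlg.eval f) (fun _ _ h => SymAlg.eval_rel f h)
                map_add' := by rintro ⟨x⟩ ⟨y⟩; rfl
                map_smul' := by rintro c ⟨x⟩; rfl }
            equivariant := by rintro n σ ⟨x⟩; rfl
            map_one := rfl
            map_mul := by rintro m n ⟨x⟩ ⟨y⟩; rfl }, fun _ _ => rfl, ?_⟩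
  intro G hG
  have key : ∀ {n : ℕ} (x : SymAlg.Pre V n), G.toFun n (Quot.mk _ x) = SymAlg.eval f x := by
    intro n x
    induction x with
    | of x => exact hG _ x
    | zero => exact map_zero (G.toFun _)
    | add x y hx hy =>
      simp only [SymAlg.eval, ← hx, ← hy]
      exact map_add (G.toFun _) (show V.symAlgebra.carrier _ from Quot.mk _ x)
        (show V.symAlgebra.carrier _ from Quot.mk _ y)
    | smul c x hx =>
      simp only [SymAlg.eval, ← hx]
      exact map_smul (G.toFun _) c (show V.symAlgebra.carrier _ from Quot.mk _ x)
    | act e x hx =>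
      obtain rfl := eq_of_finEquiv e
      simp only [SymAlg.eval, ← hx]
      exact G.equivariant _ e (Quot.mk _ x)
    | one => exact G.map_one
    | mul x y hx hy =>
      simp only [SymAlg.eval, ← hx, ← hy]
      exact G.map_mul _ _ (Quot.mk _ x) (Quot.mk _ y)
  ext n ⟨x⟩
  exact key x

/-! ### Brackets -/

/-- Twisted skew-symmetry `{w, v} = -(21)^{|v|,|w|} {v, w}` of a bracket `V ⊗ V → W`. -/
def BiHom.IsSkew {V : SModule.{u, v} k} {W : SModule.{u, w} k} (β : BiHom V V W) : Prop :=
  ∀ (a b : ℕ) (x : V a) (y : V b), β.toFun b a y x = -W.map (perm21 a b) (β.toFun a b x y)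

/-- The twisted Jacobi identity
`{x, {y, z}} + (231)^{|y|,|z|,|x|} {y, {z, x}} + (312)^{|z|,|x|,|y|} {z, {x, y}} = 0` for
`x, y, z` in `V`, where the inner bracket is `β : V ⊗ V → W` and the outer one is
`D : V ⊗ W → W`. -/
def BiHom.JacobiWith {V : SModule.{u, v} k} {W : SModule.{u, w} k} (β : BiHom V V W)
    (D : BiHom V W W) : Prop :=
  ∀ (a b c : ℕ) (x : V a) (y : V b) (z : V c),
    D.toFun a (b + c) x (β.toFun b c y z) +
      W.map (perm231 b c a) (D.toFun b (c + a) y (β.toFun c a z x)) +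
      W.map (perm312 c a b) (D.toFun c (a + b) z (β.toFun a b x y)) = 0

/-- `D : V ⊗ Sym V → Sym V` is the extension of `β : V ⊗ V → Sym V` by the Leibniz rule in the
second variable, `{x, p q} = {x, p} q + (213)^{|p|,|x|,|q|} (p {x, q})`. -/
structure BiHom.IsLeibnizExtension {V : SModule.{u, v} k} (β : BiHom V V V.Sym)
    (D : BiHom V V.Sym V.Sym) : Prop where
  extends_bracket : ∀ (a b : ℕ) (x : V a) (y : V b),
    D.toFun a b x (V.symι.toFun b y) = β.toFun a b x y
  leibniz : ∀ (a b c : ℕ) (x : V a) (p : V.Sym b) (q : V.Sym c),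
    V.Sym.map (assocB a b c).symm (D.toFun a (b + c) x (V.symAlgebra.mul.toFun b c p q)) =
      V.symAlgebra.mul.toFun (a + b) c (D.toFun a b x p) q +
        V.Sym.map (perm213 b a c) (V.symAlgebra.mul.toFun b (a + c) p (D.toFun a c x q))

end SModule

/-- A twisted Poisson structure on a twisted commutative algebra `A`: a twisted Lie bracket
`A ⊗ A → A` with the Leibniz rule `{x y, z} = x {y, z} + (213)^{|y|,|x|,|z|} (y {x, z})`. -/
structure TwistedCommAlgebra.IsPoisson {k : Type u} [Field k] (A : TwistedCommAlgebra.{u, v} k)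
    (P : BiHom A.toSModule A.toSModule A.toSModule) : Prop where
  skew : P.IsSkew
  jacobi : P.JacobiWith P
  leibniz : ∀ (a b c : ℕ) (x : A.carrier a) (y : A.carrier b) (z : A.carrier c),
    P.toFun (a + b) c (A.mul.toFun a b x y) z =
      A.toSModule.map (assocB a b c).symm (A.mul.toFun a (b + c) x (P.toFun b c y z)) +
        A.toSModule.map (perm213 b a c) (A.mul.toFun b (a + c) y (P.toFun a c x z))

/-! A derivation of `Sym V` is determined by its values on generators, and equivariant values on
generators can be prescribed freely: expand a formal expression by the Leibniz rule and check that
the result respects the relations defining `Sym V` (`evalDer_rel`). With the first argument in an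
arbitrary `𝕊`-module `U`, this gives `extendRight` and the uniqueness statement
`RightLeibniz.toFun_eq`. The construction is used twice. With `U = V` it extends `β` to `D`. With `U
= Sym V`, applied to the flipped bracket `-(21) D`, it gives the Poisson bracket `extendLeft`. The
Leibniz rule in the first argument, skew-symmetry and agreement with `D` then hold because both
sides are derivations in the last argument that agree on generators. Under skew-symmetry, the Jacobi
identity says that the derivation `{{x, y}, -}` is the commutator of `{x, -}` and `{y, -}`. It may
therefore be checked for `z` a generator; cyclic symmetry reduces the other two arguments in the
same way. Conversely, skew-symmetry and the Leibniz rule leave no choice for the bracket. -/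

namespace SModule

variable {k : Type u} [Field k]

/-! ### Block permutations as functions on natural numbers -/

/-- A bijection `Fin m ≃ Fin n` as a map on natural numbers, extended by the identity. -/
def onNat {m n : ℕ} (e : Fin m ≃ Fin n) (i : ℕ) : ℕ := if h : i < m then e ⟨i, h⟩ else i

theorem onNat_val {m n : ℕ} (e : Fin m ≃ Fin n) (i : Fin m) : onNat e i = e i := by simp [onNat]

/-- On natural numbers the reassociations of blocks become the identity and composites involve no
dependent types. Every comparison of block permutations below thus becomes piecewise linear
arithmetic. -/
theorem onNat_injective {m n : ℕ} {e f : Fin m ≃ Fin n} (h : ∀ i < m, onNat e i = onNat f i) :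
    e = f := by
  ext i
  rw [← onNat_val, ← onNat_val, h _ i.2]

theorem onNat_of_le {m n : ℕ} (e : Fin m ≃ Fin n) {i : ℕ} (h : m ≤ i) : onNat e i = i := by
  simp [onNat, h.not_gt]

/-- For an unspecified bijection inside a block, this is all the arithmetic needs to know: which
block a position lies in does not change. -/
theorem onNat_cases {m n : ℕ} (e : Fin m ≃ Fin n) (i : ℕ) :
    i < m ∧ onNat e i < m ∨ m ≤ i ∧ onNat e i = i := by
  obtain rfl := eq_of_finEquiv e
  unfold onNat
  split_ifs with h <;> simp [h, le_of_not_gt]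

theorem onNat_trans {l m n : ℕ} (e : Fin l ≃ Fin m) (f : Fin m ≃ Fin n) (i : ℕ) :
    onNat (e.trans f) i = onNat f (onNat e i) := by
  obtain rfl := eq_of_finEquiv e
  unfold onNat
  split_ifs <;> simp_all

theorem onNat_refl {n : ℕ} (i : ℕ) : onNat (Equiv.refl (Fin n)) i = i := by simp [onNat]

theorem onNat_finCongr {m n : ℕ} (h : m = n) (i : ℕ) : onNat (finCongr h) i = i := by
  simp [onNat]

theorem onNat_assocB (a b c i : ℕ) : onNat (assocB a b c) i = i := onNat_finCongr _ i

theorem onNat_assocB_symm (a b c i : ℕ) : onNat (assocB a b c).symm i = i :=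
  onNat_finCongr (Nat.add_assoc a b c).symm i

theorem onNat_blockSum {a b c d : ℕ} (e : Fin a ≃ Fin b) (f : Fin c ≃ Fin d) (i : ℕ) :
    onNat (blockSum e f) i = if i < a then onNat e i else a + onNat f (i - a) := by
  obtain rfl := eq_of_finEquiv e
  obtain rfl := eq_of_finEquiv f
  by_cases h : i < a + c
  · have := onNat_val (blockSum e f) ⟨i, h⟩
    rw [show onNat (blockSum e f) i = _ from this]
    generalize hj : (⟨i, h⟩ : Fin (a + c)) = j
    obtain rfl : i = j := by rw [← hj]
    refine Fin.addCases (fun j => ?_) (fun j => ?_) j <;> simp [blockSum, ← onNat_val]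
  · rw [onNat_of_le _ (by omega), if_neg (by omega), onNat_of_le _ (by omega)]
    omega

theorem onNat_perm21 (a b i : ℕ) : onNat (perm21 a b) i =
    if i < a then b + i else if i < a + b then i - a else i := by
  by_cases h : i < a + b
  · have := onNat_val (perm21 a b) ⟨i, h⟩
    rw [show onNat (perm21 a b) i = _ from this]
    generalize hj : (⟨i, h⟩ : Fin (a + b)) = j
    obtain rfl : i = j := by rw [← hj]
    refine Fin.addCases (fun j => ?_) (fun j => ?_) j <;> simp [perm21]
  · rw [onNat_of_le _ (by omega), if_neg (by omega), if_neg h]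

/-- The exchange of the first two of three blocks. -/
def swapB (a b c : ℕ) : Fin (a + (b + c)) ≃ Fin (b + (a + c)) :=
  (perm213 a b c).trans (assocB b a c)

theorem onNat_perm213 (a b c i : ℕ) : onNat (perm213 a b c) i =
    if i < a then b + i else if i < a + b then i - a else i := by
  simp only [perm213, onNat_trans, onNat_blockSum, onNat_assocB_symm, onNat_perm21, onNat_refl]
  grind

theorem onNat_perm231 (a b c i : ℕ) : onNat (perm231 a b c) i =
    if i < a + b then c + i else if i < a + b + c then i - (a + b) else i := by
  simp only [perm231, onNat_trans, onNat_assocB_symm, onNat_perm21]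

theorem onNat_perm312 (a b c i : ℕ) : onNat (perm312 a b c) i =
    if i < a then b + c + i else if i < a + (b + c) then i - a else i := by
  simp only [perm312, onNat_trans, onNat_assocB, onNat_perm21]

theorem onNat_swapB (a b c i : ℕ) : onNat (swapB a b c) i =
    if i < a then b + i else if i < a + b then i - a else i := by
  simp only [swapB, onNat_trans, onNat_assocB, onNat_perm213]

attribute [simp] onNat_trans onNat_refl onNat_finCongr onNat_assocB onNat_assocB_symm
  onNat_blockSum onNat_perm21 onNat_perm213 onNat_perm231 onNat_perm312
  onNat_swapB

/-! ### Actions of bijections and equivariance -/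

theorem map_eq_map (V : SModule.{u, v} k) {m n : ℕ} {e f : Fin m ≃ Fin n}
    (h : ∀ i < m, onNat e i = onNat f i) (x : V m) : V.map e x = V.map f x := by
  rw [onNat_injective h]

theorem map_eq_self (V : SModule.{u, v} k) {n : ℕ} {e : Fin n ≃ Fin n}
    (h : ∀ i < n, onNat e i = i) (x : V n) : V.map e x = x := by
  rw [map_eq_map V (f := Equiv.refl _) (by simpa only [onNat_refl] using h), map_refl]

theorem map_symm_map (V : SModule.{u, v} k) {m n : ℕ} (e : Fin m ≃ Fin n) (x : V m) :
    V.map e.symm (V.map e x) = x := by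
  rw [← map_trans, Equiv.self_trans_symm, map_refl]

theorem map_map_symm (V : SModule.{u, v} k) {m n : ℕ} (e : Fin m ≃ Fin n) (x : V n) :
    V.map e (V.map e.symm x) = x := by
  rw [← map_trans, Equiv.symm_trans_self, map_refl]

theorem map_injective (V : SModule.{u, v} k) {m n : ℕ} (e : Fin m ≃ Fin n) :
    Function.Injective (V.map e) :=
  Function.LeftInverse.injective (V.map_symm_map e)

namespace BiHom

variable {U : SModule.{u, v₁} k} {V : SModule.{u, v₂} k} {W : SModule.{u, v₃} k}

theorem map_map (B : BiHom U V W) {a b c d : ℕ} (e : Fin a ≃ Fin b) (f : Fin c ≃ Fin d)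
    (x : U a) (y : V c) :
    B.toFun b d (U.map e x) (V.map f y) = W.map (blockSum e f) (B.toFun a c x y) := by
  obtain rfl := eq_of_finEquiv e
  obtain rfl := eq_of_finEquiv f
  exact B.equivariant _ _ e f x y

theorem map_left (B : BiHom U V W) {a b c : ℕ} (e : Fin a ≃ Fin b) (x : U a) (y : V c) :
    B.toFun b c (U.map e x) y = W.map (blockSum e (Equiv.refl _)) (B.toFun a c x y) := by
  rw [← map_map, V.map_refl]

theorem map_right (B : BiHom U V W) {a c d : ℕ} (f : Fin c ≃ Fin d) (x : U a) (y : V c) :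
    B.toFun a d x (V.map f y) = W.map (blockSum (Equiv.refl _) f) (B.toFun a c x y) := by
  rw [← map_map, U.map_refl]

end BiHom

/-! ### Derivations of `Sym V` from values on generators -/

namespace SymAlg

variable {V : SModule.{u, v} k}

/-- The element of `Sym V` given by a formal expression. -/
def mk {n : ℕ} (x : Pre V n) : V.Sym n := Quot.mk _ x

theorem mk_surjective (n : ℕ) : Function.Surjective (mk : Pre V n → V.Sym n) :=
  fun x => Quot.exists_rep x

theorem mk_rel {n : ℕ} {x y : Pre V n} (h : Rel V x y) : mk x = mk y := Quot.sound h

theorem mk_zero {n : ℕ} : mk (.zero : Pre V n) = 0 := rfl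

theorem mk_add {n : ℕ} (x y : Pre V n) : mk (.add x y) = mk x + mk y := rfl

theorem mk_smul {n : ℕ} (c : k) (x : Pre V n) : mk (.smul c x) = c • mk x := rfl

theorem mk_act {m n : ℕ} (e : Fin m ≃ Fin n) (x : Pre V m) :
    mk (.act e x) = V.Sym.map e (mk x) := by
  rw [show V.Sym.map e = act V e from toSModule_map V e]; rfl

theorem mk_one : mk (.one : Pre V 0) = V.symAlgebra.one := rfl

theorem mk_mul {m n : ℕ} (x : Pre V m) (y : Pre V n) :
    mk (.mul x y) = V.symAlgebra.mul.toFun m n (mk x) (mk y) := rfl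

variable {a : ℕ} (F : ∀ n, V n →ₗ[k] V.Sym (a + n))

/-- The value on a formal expression of the derivation of degree `a` with given values on the
generators. -/
def evalDer : ∀ {n : ℕ}, Pre V n → V.Sym (a + n)
  | _, .of x => F _ x
  | _, .zero => 0
  | _, .add x y => evalDer x + evalDer y
  | _, .smul c x => c • evalDer x
  | _, .act e x => V.Sym.map (blockSum (Equiv.refl _) e) (evalDer x)
  | _, .one => 0
  | _, .mul (m := m) (n := n) x y =>
      V.Sym.map (assocB a m n) (V.symAlgebra.mul.toFun (a + m) n (evalDer x) (mk y)) +
      V.Sym.map (swapB m a n) (V.symAlgebra.mul.toFun m (a + n) (mk x) (evalDer y))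

/-- Equivariance of `F` is needed only for the relation `of_act`. The multiplicative relations hold
because both sides expand into the same products, with equal block permutations acting on them. -/
theorem evalDer_rel (hF : ∀ (n : ℕ) (σ : Equiv.Perm (Fin n)) (x : V n),
      F n (V.ρ n σ x) = V.Sym.map (blockSum (Equiv.refl _) σ) (F n x))
    {n : ℕ} {x y : Pre V n} (h : Rel V x y) : evalDer F x = evalDer F y := by
  induction h with
  | add_assoc => simp only [evalDer]; exact _root_.add_assoc _ _ _
  | add_comm => simp only [evalDer]; exact _root_.add_comm _ _
  | smul_smul => simp only [evalDer]; exact SemigroupAction.mul_smul _ _ _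
  | add_smul => simp only [evalDer]; exact _root_.add_smul _ _ _
  | act_refl x =>
    simp only [evalDer]
    exact map_eq_self _ (by simp; grind [onNat_cases]) _
  | act_trans e f x =>
    simp only [evalDer]
    rw [← map_trans]
    exact map_eq_map _ (by simp; grind [onNat_cases]) _
  | of_act σ x => simp only [evalDer]; exact hF _ _ _
  | mul_left y h ih => simp only [evalDer, ih, mk_rel h]
  | mul_right x h ih => simp only [evalDer, ih, mk_rel h]
  | add_mul x x' y => simp only [evalDer, mk_add, map_add, LinearMap.add_apply]; abel
  | mul_add x x' y => simp only [evalDer, mk_add, map_add]; abel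
  | smul_mul c x y => simp only [evalDer, mk_smul, map_smul, LinearMap.smul_apply, smul_add]
  | mul_smul c x y => simp only [evalDer, mk_smul, map_smul, smul_add]
  | @act_mul_act m n σ τ x y =>
    simp only [evalDer, mk_act, BiHom.map_map, map_add, ← map_trans]
    congr 1
    · exact map_eq_map _ (by simp; grind [onNat_cases]) _
    · exact map_eq_map _ (by simp; grind [onNat_cases]) _
  | @one_mul n x =>
    simp only [evalDer, ← map_trans, map_zero, LinearMap.zero_apply, _root_.zero_add]
    rw [mk_one]
    conv_rhs => rw [← V.symAlgebra.one_mul _ (evalDer F x)]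
    exact map_eq_map _ (by simp; grind [onNat_cases]) _
  | @mul_assoc l m n x y z =>
    simp only [evalDer, map_add, ← map_trans, mk_mul, LinearMap.add_apply, BiHom.map_left,
      BiHom.map_right, ← V.symAlgebra.mul_assoc, ← add_assoc]
    congr 1
    · congr 1
      · exact map_eq_map _ (by simp; grind [onNat_cases]) _
      · exact map_eq_map _ (by simp; grind [onNat_cases]) _
    · exact map_eq_map _ (by simp; grind [onNat_cases]) _
  | @mul_comm m n x y =>
    simp only [evalDer, map_add, ← map_trans]
    -- Commutativity turns the two Leibniz terms of `y x` into those of `x y`, in the opposite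
    -- order.
    rw [V.symAlgebra.mul_comm _ _ _ (evalDer F y), V.symAlgebra.mul_comm _ _ (evalDer F x),
      ← map_trans, ← map_trans, _root_.add_comm (V.Sym.map _ _)]
    congr 1
    · exact map_eq_map _ (by simp; grind [onNat_cases]) _
    · exact map_eq_map _ (by simp; grind [onNat_cases]) _
  | _ => simp_all [evalDer]

theorem evalDer_add (F G : ∀ n, V n →ₗ[k] V.Sym (a + n)) {n : ℕ} (p : Pre V n) :
    evalDer (fun n => F n + G n) p = evalDer F p + evalDer G p := by
  induction p with
  | add x y hx hy => simp only [evalDer, hx, hy]; abel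
  | mul x y hx hy => simp only [evalDer, hx, hy, map_add, LinearMap.add_apply]; abel
  | _ => simp_all [evalDer]

theorem evalDer_smul (c : k) (F : ∀ n, V n →ₗ[k] V.Sym (a + n)) {n : ℕ} (p : Pre V n) :
    evalDer (fun n => c • F n) p = c • evalDer F p := by
  induction p with
  | smul d x hx => simp only [evalDer, hx, smul_comm c d]
  | _ => simp_all [evalDer]

/-- This yields equivariance of the extended bracket in its first argument, whose block has size
`a`. -/
theorem evalDer_map (σ : Equiv.Perm (Fin a)) {F G : ∀ n, V n →ₗ[k] V.Sym (a + n)}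
    (h : ∀ n x, G n x = V.Sym.map (blockSum σ (Equiv.refl _)) (F n x)) {n : ℕ} (p : Pre V n) :
    evalDer G p = V.Sym.map (blockSum σ (Equiv.refl _)) (evalDer F p) := by
  induction p with
  | of x => exact h _ x
  | act e x hx =>
    simp only [evalDer, hx, ← map_trans]
    exact map_eq_map _ (by simp; grind [onNat_cases]) _
  | @mul m n x y hx hy =>
    simp only [evalDer, hx, hy, map_add, ← map_trans, BiHom.map_left, BiHom.map_right]
    congr 1
    · exact map_eq_map _ (by simp; grind [onNat_cases]) _
    · refine map_eq_map _ (fun i hi => ?_) _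
      -- In the term `x · {u, y}` the block permuted by `σ` starts at position `m`.
      have := onNat_cases σ (i - m)
      simp
      grind
  | _ => simp_all [evalDer]

end SymAlg

theorem sym_induction {V : SModule.{u, v} k} {motive : ∀ n, V.Sym n → Prop}
    (of : ∀ n x, motive n (V.symι.toFun n x))
    (add : ∀ n x y, motive n x → motive n y → motive n (x + y))
    (smul : ∀ n (c : k) x, motive n x → motive n (c • x))
    (map : ∀ m n (e : Fin m ≃ Fin n) x, motive m x → motive n (V.Sym.map e x))
    (one : motive 0 V.symAlgebra.one)
    (mul : ∀ m n x y, motive m x → motive n y → motive (m + n) (V.symAlgebra.mul.toFun m n x y))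
    {n : ℕ} (x : V.Sym n) : motive n x := by
  obtain ⟨p, rfl⟩ := SymAlg.mk_surjective n x
  induction p with
  | of x => exact of _ x
  -- Zero is the multiple by `0` of a generator, so the induction principle needs no case for it.
  | zero => simpa only [zero_smul, SymAlg.mk_zero] using smul _ 0 _ (of _ 0)
  | add x y hx hy => exact add _ _ _ hx hy
  | smul c x hx => exact smul _ _ _ hx
  | act e x hx => rw [SymAlg.mk_act]; exact map _ _ _ _ hx
  | one => exact one
  | mul x y hx hy => exact mul _ _ _ _ hx hy

/-! ### Extension by the Leibniz rule, and its uniqueness -/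

namespace BiHom

/-- The Leibniz rule `{x, p q} = {x, p} q + (213) (p {x, q})` in the second variable. -/
def RightLeibniz {U : SModule.{u, v₁} k} {A : TwistedCommAlgebra.{u, v₂} k}
    (D : BiHom U A.toSModule A.toSModule) : Prop :=
  ∀ (a b c : ℕ) (x : U a) (p : A.carrier b) (q : A.carrier c),
    D.toFun a (b + c) x (A.mul.toFun b c p q) =
      A.toSModule.map (assocB a b c) (A.mul.toFun (a + b) c (D.toFun a b x p) q) +
        A.toSModule.map (swapB b a c) (A.mul.toFun b (a + c) p (D.toFun a c x q))

variable {U : SModule.{u, v₁} k} {V : SModule.{u, v} k}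

/-- Since `1 · 1 = 1`, the Leibniz rule gives `{x, 1} = {x, 1} + {x, 1}`; the permutations involved
are identities. -/
theorem RightLeibniz.apply_one {A : TwistedCommAlgebra.{u, v₂} k}
    {D : BiHom U A.toSModule A.toSModule} (hD : D.RightLeibniz) {a : ℕ} (x : U a) :
    D.toFun a 0 x A.one = 0 := by
  have h1 : A.mul.toFun 0 0 A.one A.one = A.one := by
    conv_rhs => rw [← A.one_mul 0 A.one]
    exact (map_eq_self _ (by simp) _).symm
  have h2 : ∀ f : Fin (0 + (a + 0)) ≃ Fin (a + (0 + 0)), (∀ i, onNat f i = i) →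
      A.toSModule.map f (A.mul.toFun 0 (a + 0) A.one (D.toFun a 0 x A.one)) =
        D.toFun a 0 x A.one := by
    intro f hf
    conv_rhs => rw [← A.one_mul _ (D.toFun a 0 x A.one)]
    exact map_eq_map _ (by simp [hf]) _
  have h := hD a 0 0 x A.one A.one
  rw [A.mul_comm 0 (a + 0) A.one, ← map_trans, h2 _ (by simp), h2 _ (by simp), h1] at h
  exact left_eq_add.mp h

/-- The extension of a bracket `U ⊗ V → Sym V` by the Leibniz rule in the second variable. -/
def extendRight (B : BiHom U V V.Sym) : BiHom U V.Sym V.Sym where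
  toFun a n := LinearMap.mk₂ k
    (fun x => Quot.lift (SymAlg.evalDer fun n => B.toFun a n x)
      fun _ _ => SymAlg.evalDer_rel _ fun n σ y => B.map_right σ x y)
    (by
      rintro x x' ⟨p⟩
      simpa only [map_add] using
        SymAlg.evalDer_add (fun n => B.toFun a n x) (fun n => B.toFun a n x') p)
    (by
      rintro c x ⟨p⟩
      simpa only [map_smul] using SymAlg.evalDer_smul c (fun n => B.toFun a n x) p)
    (by rintro x ⟨p⟩ ⟨q⟩; rfl)
    (by rintro c x ⟨p⟩; rfl)
  equivariant := by
    rintro m n σ τ x ⟨p⟩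
    have h1 : SymAlg.evalDer (fun n => B.toFun m n (U.ρ m σ x)) (.act τ p) = _ :=
      SymAlg.evalDer_map σ (F := fun n => B.toFun m n x) (fun n y => B.map_left σ x y) (.act τ p)
    refine h1.trans ?_
    simp only [SymAlg.evalDer, ← map_trans]
    exact map_eq_map _ (f := blockSum σ τ) (by simp; grind [onNat_cases]) _

theorem extendRight_symι (B : BiHom U V V.Sym) (a b : ℕ) (x : U a) (y : V b) :
    B.extendRight.toFun a b x (V.symι.toFun b y) = B.toFun a b x y := rfl

theorem extendRight_rightLeibniz (B : BiHom U V V.Sym) : B.extendRight.RightLeibniz := by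
  rintro a b c x ⟨p⟩ ⟨q⟩
  rfl

/-- A derivation is determined on generators. The sources `U` and `U'` may differ, so that a bracket
on `Sym V ⊗ Sym V` can be compared with one on `V ⊗ Sym V`. -/
theorem RightLeibniz.toFun_eq {U' : SModule.{u, v₂} k} {D : BiHom U V.Sym V.Sym}
    {D' : BiHom U' V.Sym V.Sym} (hD : D.RightLeibniz) (hD' : D'.RightLeibniz) {a : ℕ} {x : U a}
    {x' : U' a} (h : ∀ b y, D.toFun a b x (V.symι.toFun b y) = D'.toFun a b x' (V.symι.toFun b y))
    {b : ℕ} (p : V.Sym b) : D.toFun a b x p = D'.toFun a b x' p := by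
  induction p using sym_induction with
  | of n y => exact h n y
  | add n p q hp hq => rw [map_add, map_add, hp, hq]
  | smul n c p hp => rw [map_smul, map_smul, hp]
  | map m n e p hp => rw [map_right, map_right, hp]
  | one => rw [hD.apply_one, hD'.apply_one]
  | mul m n p q hp hq => rw [hD, hD', hp, hq]

/-! ### Skew-symmetry and the exchange of the two Leibniz rules -/

/-- The bracket `(y, x) ↦ -(21) {x, y}`. -/
def negFlip {U : SModule.{u, v₁} k} {V : SModule.{u, v₂} k} {W : SModule.{u, v₃} k}
    (B : BiHom U V W) : BiHom V U W where
  toFun m n := -((B.toFun n m).flip.compr₂ (W.map (perm21 n m)))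
  equivariant m n σ τ x y := by
    simp only [LinearMap.neg_apply, LinearMap.compr₂_apply, LinearMap.flip_apply,
      ← map_perm, B.map_map, ← map_trans, map_neg]
    refine congrArg _ (map_eq_map _ (fun i hi => ?_) _)
    have := onNat_cases σ (i - n)
    have := onNat_cases τ i
    simp
    grind

theorem negFlip_apply {U : SModule.{u, v₁} k} {V : SModule.{u, v₂} k} {W : SModule.{u, v₃} k}
    (B : BiHom U V W) {m n : ℕ} (y : V m) (x : U n) :
    B.negFlip.toFun m n y x = -W.map (perm21 n m) (B.toFun n m x y) := rfl

/-- As an equality of brackets, skew-symmetry can be proved by uniqueness of derivations and used to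
move a Leibniz rule from one argument to the other. -/
theorem isSkew_iff {V : SModule.{u, v} k} {W : SModule.{u, w} k} {B : BiHom V V W} :
    B.IsSkew ↔ B.negFlip = B := by
  constructor
  · intro h
    ext a b x y
    rw [negFlip_apply, h b a y x]
  · intro h a b x y
    rw [← negFlip_apply, h]

/-- The Leibniz rule `{x y, z} = x {y, z} + (213) (y {x, z})` in the first variable. -/
def LeftLeibniz {U : SModule.{u, v₁} k} {A : TwistedCommAlgebra.{u, v₂} k}
    (D : BiHom A.toSModule U A.toSModule) : Prop :=
  ∀ (a b c : ℕ) (x : A.carrier a) (y : A.carrier b) (z : U c),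
    D.toFun (a + b) c (A.mul.toFun a b x y) z =
      A.toSModule.map (assocB a b c).symm (A.mul.toFun a (b + c) x (D.toFun b c y z)) +
        A.toSModule.map (perm213 b a c) (A.mul.toFun b (a + c) y (D.toFun a c x z))

theorem RightLeibniz.apply_mul {U : SModule.{u, v₁} k} {A : TwistedCommAlgebra.{u, v₂} k}
    {D : BiHom U A.toSModule A.toSModule} (hD : D.RightLeibniz) (a b c : ℕ) (x : U a)
    (p : A.carrier b) (q : A.carrier c) :
    D.toFun a (b + c) x (A.mul.toFun b c p q) =
      A.toSModule.map (assocB a b c) (A.mul.toFun (a + b) c (D.toFun a b x p) q) +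
        A.toSModule.map (swapB b a c) (A.mul.toFun b (a + c) p (D.toFun a c x q)) :=
  hD a b c x p q

theorem LeftLeibniz.mul_apply {U : SModule.{u, v₁} k} {A : TwistedCommAlgebra.{u, v₂} k}
    {D : BiHom A.toSModule U A.toSModule} (hD : D.LeftLeibniz) (a b c : ℕ) (x : A.carrier a)
    (y : A.carrier b) (z : U c) :
    D.toFun (a + b) c (A.mul.toFun a b x y) z =
      A.toSModule.map (assocB a b c).symm (A.mul.toFun a (b + c) x (D.toFun b c y z)) +
        A.toSModule.map (perm213 b a c) (A.mul.toFun b (a + c) y (D.toFun a c x z)) :=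
  hD a b c x y z

variable {U : SModule.{u, v₁} k} {A : TwistedCommAlgebra.{u, v₂} k}

theorem RightLeibniz.negFlip {D : BiHom U A.toSModule A.toSModule} (hD : D.RightLeibniz) :
    D.negFlip.LeftLeibniz := by
  intro a b c x y z
  simp only [negFlip_apply, hD.apply_mul, map_add, map_neg, map_right, ← map_trans, neg_add_rev]
  rw [A.mul_comm _ _ y (D.toFun c a z x), ← map_trans]
  congr 2
  · exact map_eq_map _ (by simp; grind) _
  · exact map_eq_map _ (by simp; grind) _

theorem LeftLeibniz.negFlip {D : BiHom A.toSModule U A.toSModule} (hD : D.LeftLeibniz) :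
    D.negFlip.RightLeibniz := by
  intro a b c x p q
  simp only [negFlip_apply, hD.mul_apply, map_add, map_neg, map_right, map_left, ← map_trans,
    neg_add_rev, LinearMap.neg_apply]
  rw [A.mul_comm _ _ q (D.toFun b a p x), ← map_trans]
  congr 2
  · exact map_eq_map _ (by simp; grind) _
  · exact map_eq_map _ (by simp; grind) _

/-- The two forms of the rule differ by a reassociation, which acts injectively. -/
theorem isLeibnizExtension_iff {V : SModule.{u, v} k} {β : BiHom V V V.Sym}
    {D : BiHom V V.Sym V.Sym} : β.IsLeibnizExtension D ↔
      (∀ a b x y, D.toFun a b x (V.symι.toFun b y) = β.toFun a b x y) ∧ D.RightLeibniz := by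
  have key : ∀ (a b c : ℕ) (s : V.Sym (a + (b + c))) (t : V.Sym (a + b + c))
      (r : V.Sym (b + (a + c))),
      V.Sym.map (assocB a b c).symm s = t + V.Sym.map (perm213 b a c) r ↔
        s = V.Sym.map (assocB a b c) t + V.Sym.map (swapB b a c) r := by
    intro a b c s t r
    rw [← (V.Sym.map_injective (assocB a b c)).eq_iff, map_map_symm, map_add, swapB, map_trans]
  exact ⟨fun h => ⟨h.1, fun a b c x p q => (key ..).mp (h.2 a b c x p q)⟩,
    fun h => ⟨h.1, fun a b c x p q => (key ..).mpr (h.2 a b c x p q)⟩⟩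

variable {V : SModule.{u, v} k} {P : BiHom V.Sym V.Sym V.Sym}

/-- For fixed `x` and `y`, both sides of the rule are derivations in the last argument, so
generators suffice there. -/
theorem RightLeibniz.leftLeibniz (hP : P.RightLeibniz)
    (h : ∀ (a b c : ℕ) (x : V.Sym a) (y : V.Sym b) (z : V c),
      P.toFun (a + b) c (V.symAlgebra.mul.toFun a b x y) (V.symι.toFun c z) =
        V.Sym.map (assocB a b c).symm
          (V.symAlgebra.mul.toFun a (b + c) x (P.toFun b c y (V.symι.toFun c z))) +
        V.Sym.map (perm213 b a c)
          (V.symAlgebra.mul.toFun b (a + c) y (P.toFun a c x (V.symι.toFun c z)))) :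
    P.LeftLeibniz := by
  intro a b c x y z
  induction z using sym_induction with
  | of n z => exact h a b n x y z
  | add n p q hp hq => simp only [map_add, hp, hq]; abel
  | smul n t p hp => simp only [map_smul, hp, smul_add]
  | map m n e p hp =>
    simp only [map_right, hp, map_add, ← map_trans]
    congr 1
    · exact map_eq_map _ (by simp; grind [onNat_cases]) _
    · exact map_eq_map _ (by simp; grind [onNat_cases]) _
  | one => simp only [hP.apply_one, map_zero, add_zero]
  | mul m n p q hp hq =>
    rw [hP, hP, hP, hp, hq]
    simp only [map_add, LinearMap.add_apply, map_left, map_right, ← map_trans,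
      ← V.symAlgebra.mul_assoc]
    -- Expanding `{x y, p q}` from the left puts `p` in front of `x` and `y` in two of the four
    -- terms; from the right it comes after them.
    rw [V.symAlgebra.mul_comm _ _ x p, V.symAlgebra.mul_comm _ _ y p]
    simp only [map_left, ← map_trans]
    rw [add_add_add_comm (V.Sym.map _ _)]
    congr 2
    · exact map_eq_map _ (by simp; grind) _
    · exact map_eq_map _ (by simp; grind) _
    · exact map_eq_map _ (by simp; grind) _
    · exact map_eq_map _ (by simp; grind (splits := 20)) _

/-! ### Reduction of the Jacobi identity to generators -/

/-- The twisted Jacobi identity for three given elements. -/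
def JacobiAt {W : SModule.{u, v} k} (P : BiHom W W W) {a b c : ℕ} (x : W a) (y : W b) (z : W c) :
    Prop :=
  P.toFun a (b + c) x (P.toFun b c y z) +
    W.map (perm231 b c a) (P.toFun b (c + a) y (P.toFun c a z x)) +
    W.map (perm312 c a b) (P.toFun c (a + b) z (P.toFun a b x y)) = 0

/-- Acting by `(312)` cancels the permutation on the second summand, which becomes the first one of
the rotated identity. -/
theorem JacobiAt.cyclic {W : SModule.{u, v} k} {P : BiHom W W W} {a b c : ℕ} {x : W a} {y : W b}
    {z : W c} (h : P.JacobiAt x y z) : P.JacobiAt y z x := by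
  have h' := congrArg (W.map (perm312 a b c)) h
  rw [map_zero, map_add, map_add, ← map_trans, ← map_trans,
    map_eq_self (e := (perm231 b c a).trans (perm312 a b c)) _ (by simp; grind)] at h'
  rw [add_assoc, add_comm (W.map _ _)] at h'
  refine Eq.trans ?_ h'
  congr 1
  rw [map_eq_map _ (e := (perm312 c a b).trans _) (f := perm231 c a b) (by simp; grind)]

/-- In this commutator form `z` is in the last slot of every bracket containing it, so induction on
`z` uses only the right Leibniz rule. -/
theorem IsSkew.jacobiAt_iff {W : SModule.{u, v} k} {P : BiHom W W W} (hP : P.IsSkew) {a b c : ℕ}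
    (x : W a) (y : W b) (z : W c) : P.JacobiAt x y z ↔
      P.toFun a (b + c) x (P.toFun b c y z) =
        W.map (swapB b a c) (P.toFun b (a + c) y (P.toFun a c x z)) +
          W.map (assocB a b c) (P.toFun (a + b) c (P.toFun a b x y) z) := by
  rw [JacobiAt, hP a c x z, hP _ _ (P.toFun a b x y) z]
  simp only [map_neg, map_right, ← map_trans]
  rw [map_eq_map _ (f := swapB b a c) (by simp; grind),
    map_eq_map _ (e := (perm21 (a + b) c).trans _) (f := assocB a b c) (by simp; grind),
    add_assoc, ← neg_add, ← sub_eq_add_neg, sub_eq_zero]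

theorem JacobiAt.of_generators (hP : P.RightLeibniz) (hs : P.IsSkew) {a b c : ℕ} {x : V.Sym a}
    {y : V.Sym b} (h : ∀ n z, P.JacobiAt x y (V.symι.toFun n z)) (z : V.Sym c) :
    P.JacobiAt x y z := by
  simp only [hs.jacobiAt_iff] at h ⊢
  induction z using sym_induction with
  | of n z => exact h n z
  | add n p q hp hq => simp only [map_add, hp, hq]; abel
  | smul n t p hp => simp only [map_smul, hp, smul_add]
  | map m n e p hp =>
    simp only [map_right, hp, map_add, ← map_trans]
    congr 1
    · exact map_eq_map _ (by simp; grind [onNat_cases]) _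
    · exact map_eq_map _ (by simp; grind [onNat_cases]) _
  | one => simp only [hP.apply_one, map_zero, add_zero]
  | mul m n p q hp hq =>
    simp only [hP.apply_mul, map_add, map_right, hp, hq, LinearMap.add_apply, map_left, ← map_trans]
    -- Here `t₃` and `t₄` are the mixed products `{y, p} {x, q}` and `{x, p} {y, q}`, which occur on
    -- both sides; the other terms come from the induction hypotheses.
    have key : ∀ t₁ t₂ t₃ t₄ t₅ t₆ : V.Sym (a + (b + (m + n))),
        t₁ + t₂ + t₃ + (t₄ + (t₅ + t₆)) = t₁ + t₄ + (t₃ + t₅) + (t₂ + t₆) := by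
      intros; abel
    refine (key _ _ _ _ _ _).trans (congrArg₂ _ (congrArg₂ _ (congrArg₂ _ ?_ ?_)
      (congrArg₂ _ ?_ ?_)) (congrArg₂ _ ?_ ?_)) <;>
    exact map_eq_map _ (by simp; grind (splits := 20)) _

variable {V : SModule.{u, v} k} {β : BiHom V V V.Sym} {D : BiHom V V.Sym V.Sym}
  {P : BiHom V.Sym V.Sym V.Sym}

/-- Each cyclic rotation brings another argument into the last place, where it can be replaced by
generators. -/
theorem jacobiAt_of_generators (hP : P.RightLeibniz) (hs : P.IsSkew)
    (h : ∀ (a b c : ℕ) (x : V a) (y : V b) (z : V c),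
      P.JacobiAt (V.symι.toFun a x) (V.symι.toFun b y) (V.symι.toFun c z)) : P.JacobiWith P := by
  have h₁ : ∀ (a b c : ℕ) (x : V a) (y : V b) (z : V.Sym c),
      P.JacobiAt (V.symι.toFun a x) (V.symι.toFun b y) z :=
    fun a b c x y => .of_generators hP hs fun n z => h a b n x y z
  have h₂ : ∀ (a b c : ℕ) (x : V a) (y : V.Sym b) (z : V.Sym c),
      P.JacobiAt (V.symι.toFun a x) y z :=
    fun a b c x y => .of_generators hP hs fun n z => (h₁ n a b z x y).cyclic
  exact fun a b c x y => JacobiAt.of_generators hP hs fun n z => (h₂ n a b z x y).cyclic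

/-! ### The Poisson bracket on `Sym V` -/

theorem apply_symι_left (hP : P.RightLeibniz) (hD : D.RightLeibniz)
    (h : ∀ (a b : ℕ) (x : V a) (y : V b), P.toFun a b (V.symι.toFun a x) (V.symι.toFun b y) =
      D.toFun a b x (V.symι.toFun b y)) (a b : ℕ) (x : V a) (y : V.Sym b) :
    P.toFun a b (V.symι.toFun a x) y = D.toFun a b x y :=
  hP.toFun_eq hD (fun b y => h a b x y) y

/-- The extension of a bracket `V ⊗ Sym V → Sym V` to `Sym V ⊗ Sym V` by the Leibniz rule. -/
def extendLeft (D : BiHom V V.Sym V.Sym) : BiHom V.Sym V.Sym V.Sym := D.negFlip.extendRight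

theorem extendLeft_symι_right (D : BiHom V V.Sym V.Sym) (a b : ℕ) (x : V.Sym a) (y : V b) :
    D.extendLeft.toFun a b x (V.symι.toFun b y) =
      -V.Sym.map (perm21 b a) (D.toFun b a y x) := rfl

theorem extendLeft_symι_symι (hβ : β.IsSkew)
    (h : ∀ a b x y, D.toFun a b x (V.symι.toFun b y) = β.toFun a b x y) (a b : ℕ) (x : V a)
    (y : V b) :
    D.extendLeft.toFun a b (V.symι.toFun a x) (V.symι.toFun b y) = β.toFun a b x y := by
  rw [extendLeft_symι_right, h, ← hβ]

theorem extendLeft_rightLeibniz (D : BiHom V V.Sym V.Sym) : D.extendLeft.RightLeibniz :=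
  extendRight_rightLeibniz _

/-- On a generator in the last argument the bracket is the flip of `D`, so the rule there is the
flipped Leibniz rule of `D`. -/
theorem extendLeft_leftLeibniz (hD : D.RightLeibniz) : D.extendLeft.LeftLeibniz :=
  (extendLeft_rightLeibniz D).leftLeibniz fun a b c x y z => hD.negFlip a b c x y z

theorem extendLeft_symι_left (hβ : β.IsSkew)
    (h : ∀ a b x y, D.toFun a b x (V.symι.toFun b y) = β.toFun a b x y) (hD : D.RightLeibniz)
    (a b : ℕ) (x : V a) (y : V.Sym b) :
    D.extendLeft.toFun a b (V.symι.toFun a x) y = D.toFun a b x y :=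
  apply_symι_left (extendLeft_rightLeibniz D) hD
    (fun a b x y => by rw [extendLeft_symι_symι hβ h, h]) a b x y

/-- The bracket and its negated flip are both derivations in the second argument; on a generator `y`
there, both are `-(21) {y, x}` computed with `D`. -/
theorem extendLeft_isSkew (hβ : β.IsSkew)
    (h : ∀ a b x y, D.toFun a b x (V.symι.toFun b y) = β.toFun a b x y) (hD : D.RightLeibniz) :
    D.extendLeft.IsSkew := by
  rw [isSkew_iff]
  ext a b x y
  refine (extendLeft_leftLeibniz hD).negFlip.toFun_eq (extendLeft_rightLeibniz D)
    (fun b y => ?_) y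
  rw [negFlip_apply, extendLeft_symι_left hβ h hD, extendLeft_symι_right]

theorem extendLeft_isPoisson (hβ : β.IsSkew)
    (h : ∀ a b x y, D.toFun a b x (V.symι.toFun b y) = β.toFun a b x y) (hD : D.RightLeibniz)
    (hJ : β.JacobiWith D) : V.symAlgebra.IsPoisson D.extendLeft where
  skew := extendLeft_isSkew hβ h hD
  leibniz := extendLeft_leftLeibniz hD
  jacobi := jacobiAt_of_generators (extendLeft_rightLeibniz D) (extendLeft_isSkew hβ h hD)
    fun a b c x y z => by
      simp only [JacobiAt, extendLeft_symι_symι hβ h, extendLeft_symι_left hβ h hD]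
      exact hJ a b c x y z

/-- Skew-symmetry makes `P` a derivation in its second argument too. Hence `D` determines it for a
generator on the left, then by skewness for a generator on the right, and then everywhere. -/
theorem eq_extendLeft (hP : V.symAlgebra.IsPoisson P) (hD : D.RightLeibniz)
    (h : ∀ (a b : ℕ) (x : V a) (y : V b), P.toFun a b (V.symι.toFun a x) (V.symι.toFun b y) =
      D.toFun a b x (V.symι.toFun b y)) : P = D.extendLeft := by
  have hR : P.RightLeibniz := by
    rw [← isSkew_iff.mp hP.skew]
    exact LeftLeibniz.negFlip hP.leibniz
  ext a b x y
  refine hR.toFun_eq (extendLeft_rightLeibniz D) (fun b y => ?_) y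
  rw [extendLeft_symι_right, hP.skew b a, apply_symι_left hR hD h]

end BiHom

end SModule

theorem mainTheorem4 {k : Type u} [Field k] [CharZero k] (V : SModule.{u, v} k)
    (β : SModule.BiHom V V V.Sym) (hskew : β.IsSkew) :
    (∃! D : SModule.BiHom V V.Sym V.Sym, β.IsLeibnizExtension D) ∧
    ((∀ D : SModule.BiHom V V.Sym V.Sym, β.IsLeibnizExtension D → β.JacobiWith D) →
      ∃! P : SModule.BiHom V.Sym V.Sym V.Sym, V.symAlgebra.IsPoisson P ∧
        ∀ (a b : ℕ) (x : V a) (y : V b),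
          P.toFun a b (V.symι.toFun a x) (V.symι.toFun b y) = β.toFun a b x y) := by
  have hβ := β.extendRight_symι
  have hD := β.extendRight_rightLeibniz
  have hext : β.IsLeibnizExtension β.extendRight := BiHom.isLeibnizExtension_iff.mpr ⟨hβ, hD⟩
  refine ⟨⟨β.extendRight, hext, fun D' h' => ?_⟩, fun hJ => ⟨β.extendRight.extendLeft,
    ⟨BiHom.extendLeft_isPoisson hskew hβ hD (hJ _ hext), BiHom.extendLeft_symι_symι hskew hβ⟩,
    fun P hP => BiHom.eq_extendLeft hP.1 hD fun a b x y => by rw [hP.2, hβ]⟩⟩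
  obtain ⟨h₁, h₂⟩ := BiHom.isLeibnizExtension_iff.mp h'
  ext a b x y
  exact h₂.toFun_eq hD (fun b y => by rw [h₁, hβ]) y
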